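/- Let $(X,\mu)$ be a standard Borel probability space, $T$ an invertible bimeasurable transformation of $X$ preserving $\mu$, and let $\mu=\int_A \mu_\alpha\,d\nu(\alpha)$ be a decomposition of $\mu$ into ergodic components: $(A,\nu)$ is a probability space, $\alpha\mapsto\mu_\alpha$ is a measurable family of probability measures on $X$, and $\mu_\alpha$ is $T$-invariant and ergodic for $\nu$-almost every $\alpha$. Definitions, for a $T$-invariant probability measure $m$ on $X$. A semimetric $\rho$ (it may vanish off the diagonal) on $X$ that is measurable with respect to the completion of $m\times m$ is *admissible* if $(X_0,\rho)$ is separable for some $X_0\subset X$ with $m(X_0)=1$, *summable* if $\int_{X\times X}\rho\,d(m\times m)<\infty$, and *$T$-generating* if there is $X_0$ with $m(X_0)=1$ such that for all distinct $x,y\in X_0$ there is $n\in\mathbb Z$ with $\rho(T^nx,T^ny)>0$. Put $T^n_{av}\rho(x,y)=\frac1n\sum_{i=0}^{n-1}\rho(T^ix,T^iy)$. For $0<\varepsilon<1$, $\mathbb H_\varepsilon(X,m,\rho)=\log k$, where $k\in\mathbb N\cup\{\infty\}$ is minimal such that $X=X_0\cup X_1\cup\dots\cup X_k$ with measurable $X_j$,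 $m(X_0)<\varepsilon$ and $\mathrm{diam}_\rho(X_j)<\varepsilon$ for $1\le j\le k$; for $\varepsilon\ge1$, $\mathbb H_\varepsilon=0$. For functions $\Phi,\Psi$ of $\varepsilon>0$ and $n\in\mathbb N$ with values in $[0,\infty]$ write $\Phi\preceq\Psi$ if for every $\varepsilon>0$ there is $\delta>0$ with $\Phi(\varepsilon,n)=O(\Psi(\delta,n))$ as $n\to\infty$, and $\Phi\asymp\Psi$ if $\Phi\preceq\Psi\preceq\Phi$. The scaling entropy $\mathcal H(X,m,T)$ is the set of all functions $\Phi$ such that $\Phi\asymp\Phi_\rho$, where $\Phi_\rho(\varepsilon,n)=\mathbb H_\varepsilon(X,m,T^n_{av}\rho)$, for some summable admissible $T$-generating semimetric $\rho$ on $(X,m)$. Statement. Let $h=(h_n)$ be a sequence of nonnegative numbers, regarded as a function of $(\varepsilon,n)$ that does not depend on $\varepsilon$, and let $E\subset A$ have positive (outer) $\nu$-measure. Suppose that for every $\alpha\in E$ there is $\Phi\in\mathcal H(X,\mu_\alpha,T)$ with $h\preceq\Phi$. Then $\mathcal H(X,\mu,T)$ is nonempty, and $h\preceq\Phi$ for every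 $\Phi\in\mathcal H(X,\mu,T)$. -/

import Mathlib

open MeasureTheory ProbabilityTheory Filter
open scoped ENNReal NNReal

namespace ScalingEntropy

variable {X : Type*}

/-- A semimetric (pseudometric): a nonnegative symmetric function of two variables that vanishes
on the diagonal and satisfies the triangle inequality. -/
structure IsSemimetric (ρ : X → X → ℝ) : Prop where
  nonneg : ∀ x y, 0 ≤ ρ x y
  self : ∀ x, ρ x x = 0
  symm : ∀ x y, ρ x y = ρ y x
  triangle : ∀ x y z, ρ x z ≤ ρ x y + ρ y z

/-- The subset `S` with the semimetric `ρ` is separable. -/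
def IsSeparableOn (ρ : X → X → ℝ) (S : Set X) : Prop :=
  ∃ D : Set X, D ⊆ S ∧ D.Countable ∧ ∀ x ∈ S, ∀ ε : ℝ, 0 < ε → ∃ d ∈ D, ρ x d < ε

/-- A semimetric on `(X, μ)` is admissible if it is measurable (with respect to the completion of
`μ × μ`) and separable on some set of full measure. -/
structure IsAdmissible [MeasurableSpace X] (μ : Measure X) (ρ : X → X → ℝ) : Prop where
  semimetric : IsSemimetric ρ
  measurable : AEMeasurable (Function.uncurry ρ) (μ.prod μ)
  separable : ∃ S : Set X, (∀ᵐ x ∂μ, x ∈ S) ∧ IsSeparableOn ρ S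

/-- The cone of summable admissible semimetrics on `(X, μ)`. -/
def Adm [MeasurableSpace X] (μ : Measure X) : Set (X → X → ℝ) :=
  {ρ | IsAdmissible μ ρ ∧ Integrable (Function.uncurry ρ) (μ.prod μ)}

/-- `ρ` is `T`-generating: its translations by the powers `T ^ n`, `n ∈ ℤ`, separate the points of
some set of full measure. -/
def IsGenerating [MeasurableSpace X] (μ : Measure X) (T : X ≃ᵐ X) (ρ : X → X → ℝ) : Prop :=
  ∃ S : Set X, (∀ᵐ x ∂μ, x ∈ S) ∧ ∀ x ∈ S, ∀ y ∈ S, x ≠ y →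
    ∃ n : ℤ, 0 < ρ (((T.toEquiv : Equiv.Perm X) ^ n) x) (((T.toEquiv : Equiv.Perm X) ^ n) y)

/-- The average of the first `n` translations of `ρ` by `T`. -/
noncomputable def averageSemimetric (T : X → X) (n : ℕ) (ρ : X → X → ℝ) : X → X → ℝ :=
  fun x y => (1 / (n : ℝ)) * ∑ i ∈ Finset.range n, ρ (T^[i] x) (T^[i] y)

/-- The diameter of `S` with respect to `ρ`. -/
noncomputable def diam (ρ : X → X → ℝ) (S : Set X) : ℝ≥0∞ :=
  ⨆ x ∈ S, ⨆ y ∈ S, ENNReal.ofReal (ρ x y)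

/-- `X` is a union of measurable sets `X₀, Y₁, …, Y_k` with `μ X₀ < ε` and every `Y_j` of
`ρ`-diameter `< ε`. -/
def HasCover [MeasurableSpace X] (μ : Measure X) (ρ : X → X → ℝ) (ε : ℝ) (k : ℕ) : Prop :=
  ∃ (X₀ : Set X) (Y : Fin k → Set X), MeasurableSet X₀ ∧ (∀ j, MeasurableSet (Y j)) ∧
    X₀ ∪ ⋃ j, Y j = Set.univ ∧ μ X₀ < ENNReal.ofReal ε ∧
    ∀ j, diam ρ (Y j) < ENNReal.ofReal ε

open Classical in
/-- The `ε`-entropy of `(X, μ, ρ)`: the logarithm of the minimal `k` for which `HasCover` holds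
(`∞` if there is no such `k`), and `0` if `ε ≥ 1`. -/
noncomputable def epsEntropy [MeasurableSpace X] (μ : Measure X) (ρ : X → X → ℝ) (ε : ℝ) : ℝ≥0∞ :=
  if 1 ≤ ε then 0 else ⨅ (k : ℕ) (_ : HasCover μ ρ ε k), ENNReal.ofReal (Real.log k)

/-- `a ≼ b` for sequences: `a n = O(b n)` as `n → ∞`. -/
def SeqLE (a b : ℕ → ℝ≥0∞) : Prop :=
  ∃ C : ℝ≥0, ∀ᶠ n in atTop, a n ≤ C * b n

/-- `Φ ≼ Ψ`, that is, `Ψ` asymptotically dominates `Φ`: for every `ε > 0` there is `δ > 0` with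
`Φ(ε, n) = O(Ψ(δ, n))` as `n → ∞`. -/
def AsympLE (Φ Ψ : ℝ → ℕ → ℝ≥0∞) : Prop :=
  ∀ ε : ℝ, 0 < ε → ∃ δ : ℝ, 0 < δ ∧ SeqLE (Φ ε) (Ψ δ)

/-- Asymptotic equivalence of functions of `(ε, n)`. -/
def AsympEquiv (Φ Ψ : ℝ → ℕ → ℝ≥0∞) : Prop :=
  AsympLE Φ Ψ ∧ AsympLE Ψ Φ

/-- The function `(ε, n) ↦ ℍ_ε(X, μ, T_av^n ρ)`. -/
noncomputable def entropyFunction [MeasurableSpace X] (μ : Measure X) (T : X ≃ᵐ X)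
    (ρ : X → X → ℝ) : ℝ → ℕ → ℝ≥0∞ :=
  fun ε n => epsEntropy μ (averageSemimetric T n ρ) ε

/-- The scaling entropy of `(X, μ, T)`: the functions that are asymptotically equivalent to the
entropy function of some summable admissible `T`-generating semimetric. -/
def scalingEntropy [MeasurableSpace X] (μ : Measure X) (T : X ≃ᵐ X) : Set (ℝ → ℕ → ℝ≥0∞) :=
  {Φ | ∃ ρ ∈ Adm μ, IsGenerating μ T ρ ∧ AsympEquiv Φ (entropyFunction μ T ρ)}

end ScalingEntropy

namespace ScalingEntropy

variable {X : Type*}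

/-! The heart is `entropyFunction_asympLE`: for an invariant measure, the entropy function of a
generating semimetric `ρ` dominates that of every summable admissible `σ`. Indeed `σ` is bounded by
a multiple of a finite sum of translations of `ρ`, up to an error `g x + g y` with `∫ g` small
(`isControlled_of_generating`). Averaging over an orbit of length `n` turns that sum into a multiple
of the averaged `ρ`, up to boundary terms of order `1 / n` in the mean (`exists_average_le`), and
Markov's inequality transfers covers from `ρ` to `σ` (`HasCover.of_le`).

Hence every entropy function can be compared with that of one bounded metric, `realMetric`, which is
generating for `μ` and all components at once. A bound by `h` on each component of `E` holds with
uniform constants on a set of components of positive outer measure, by countable subadditivity. A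
sufficiently fine cover for `μ` is a cover for some component in that set
(`exists_hasCover_component`), so its cardinality obeys the component's lower bound. -/

/-! ### Semimetrics, separability and cuts. -/

theorem IsSemimetric.abs_sub_le {ρ : X → X → ℝ} (hρ : IsSemimetric ρ) (x y d : X) :
    |ρ x d - ρ y d| ≤ ρ x y := by
  have h1 := hρ.triangle x y d
  have h2 := hρ.triangle y x d
  rw [hρ.symm y x] at h2
  exact abs_le.2 ⟨by linarith, by linarith⟩

theorem IsSemimetric.ofReal_triangle {ρ : X → X → ℝ} (hρ : IsSemimetric ρ) (x y d : X) :
    ENNReal.ofReal (ρ x y) ≤ ENNReal.ofReal (ρ x d) + ENNReal.ofReal (ρ y d) := by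
  rw [← ENNReal.ofReal_add (hρ.nonneg _ _) (hρ.nonneg _ _), hρ.symm y d]
  exact ENNReal.ofReal_le_ofReal (hρ.triangle _ _ _)

/-- The dense set of `S` may miss `S'`; it is replaced by one point of `S'` from each ball of radius
`1 / (n + 1)` about its points that meets `S'`. -/
theorem IsSeparableOn.mono {ρ : X → X → ℝ} (hρ : IsSemimetric ρ) {S S' : Set X}
    (hS : IsSeparableOn ρ S) (h : S' ⊆ S) : IsSeparableOn ρ S' := by
  obtain ⟨D, -, hDc, hD⟩ := hS
  classical
  have key : ∀ p : X × ℕ, ∃ F : Set X, F ⊆ S' ∧ F.Countable ∧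
      ∀ x ∈ S', ρ x p.1 < 1 / (p.2 + 1) → ∃ d ∈ F, ρ x d < 2 / (p.2 + 1) := by
    intro p
    by_cases hp : ∃ z ∈ S', ρ z p.1 < 1 / (p.2 + 1)
    · obtain ⟨z, hz, hzp⟩ := hp
      refine ⟨{z}, by simpa using hz, Set.countable_singleton z, fun x _ hx => ⟨z, rfl, ?_⟩⟩
      have := hρ.triangle x p.1 z
      rw [hρ.symm p.1 z] at this
      calc ρ x z ≤ _ := this
        _ < 1 / (p.2 + 1) + 1 / (p.2 + 1) := add_lt_add hx hzp
        _ = _ := by ring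
    · exact ⟨∅, Set.empty_subset _, Set.countable_empty, fun x hx hxp => (hp ⟨x, hx, hxp⟩).elim⟩
  choose F hFS hFc hF using key
  refine ⟨⋃ p ∈ D ×ˢ (Set.univ : Set ℕ), F p, Set.iUnion₂_subset fun p _ => hFS p,
    (hDc.prod Set.countable_univ).biUnion fun p _ => hFc p, fun x hx ε hε => ?_⟩
  obtain ⟨n, hn⟩ := exists_nat_one_div_lt (half_pos hε)
  obtain ⟨d, hd, hxd⟩ := hD x (h hx) (1 / (n + 1)) (by positivity)
  obtain ⟨e, he, hxe⟩ := hF (d, n) x hx hxd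
  refine ⟨e, Set.mem_biUnion (x := (d, n)) ⟨hd, trivial⟩ he, hxe.trans ?_⟩
  have : (2 : ℝ) / (n + 1) = 2 * (1 / (n + 1)) := by ring
  simp only [this]
  linarith

open Classical in
/-- The semimetric that separates `A` from its complement. -/
noncomputable def cut (A : Set X) (x y : X) : ℝ≥0∞ := if x ∈ A ↔ y ∈ A then 0 else 1

theorem cut_eq_zero {A : Set X} {x y : X} (h : x ∈ A ↔ y ∈ A) : cut A x y = 0 := if_pos h

theorem cut_eq_one {A : Set X} {x y : X} (h : ¬ (x ∈ A ↔ y ∈ A)) : cut A x y = 1 := if_neg h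

theorem cut_le_one (A : Set X) (x y : X) : cut A x y ≤ 1 := by
  by_cases h : x ∈ A ↔ y ∈ A
  · simp [cut_eq_zero h]
  · simp [cut_eq_one h]

theorem cut_comm (A : Set X) (x y : X) : cut A x y = cut A y x := by
  by_cases h : x ∈ A ↔ y ∈ A
  · rw [cut_eq_zero h, cut_eq_zero h.symm]
  · rw [cut_eq_one h, cut_eq_one fun h' => h h'.symm]

theorem cut_congr {A B : Set X} {x y : X} (hx : x ∈ A ↔ x ∈ B) (hy : y ∈ A ↔ y ∈ B) :
    cut A x y = cut B x y := by
  by_cases h : x ∈ A ↔ y ∈ A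
  · rw [cut_eq_zero h, cut_eq_zero (hx.symm.trans (h.trans hy))]
  · rw [cut_eq_one h, cut_eq_one fun h' => h (hx.trans (h'.trans hy.symm))]

theorem cut_compl (A : Set X) (x y : X) : cut Aᶜ x y = cut A x y := by
  by_cases h : x ∈ A ↔ y ∈ A
  · rw [cut_eq_zero h, cut_eq_zero (not_congr h)]
  · rw [cut_eq_one h, cut_eq_one fun h' => h (not_iff_not.1 h')]

theorem cut_le_of_symm {A : Set X} {B : X → X → ℝ≥0∞} (hB : ∀ x y, B x y = B y x)
    (h : ∀ x ∈ A, ∀ y ∉ A, 1 ≤ B x y) (x y : X) : cut A x y ≤ B x y := by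
  by_cases hiff : x ∈ A ↔ y ∈ A
  · exact (cut_eq_zero hiff).trans_le zero_le
  · refine (cut_le_one A x y).trans ?_
    by_cases hx : x ∈ A
    · exact h x hx y fun hy => hiff (iff_of_true hx hy)
    · exact hB x y ▸ h y (by_contra fun hy => hiff (iff_of_false hx hy)) x hx

theorem diam_le_iff {σ : X → X → ℝ} {S : Set X} {c : ℝ≥0∞} :
    diam σ S ≤ c ↔ ∀ x ∈ S, ∀ y ∈ S, ENNReal.ofReal (σ x y) ≤ c := by
  simp only [diam, iSup_le_iff]

/-! ### Powers of `T`, dense sequences and integrable majorants. -/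

variable [MeasurableSpace X]

/-- The power `T ^ k`, `k ∈ ℤ`, as a map of `X`. -/
def zpowMap (T : X ≃ᵐ X) (k : ℤ) : X → X := ⇑((T.toEquiv : Equiv.Perm X) ^ k)

theorem zpowMap_add (T : X ≃ᵐ X) (j k : ℤ) (x : X) :
    zpowMap T (j + k) x = zpowMap T j (zpowMap T k x) := by
  simp only [zpowMap, zpow_add, Equiv.Perm.mul_apply]

theorem iterate_eq_zpowMap (T : X ≃ᵐ X) (n : ℕ) (x : X) : T^[n] x = zpowMap T n x := by
  simp only [zpowMap, zpow_natCast, ← Equiv.Perm.iterate_eq_pow]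
  rfl

theorem zpowMap_neg_natCast (T : X ≃ᵐ X) (n : ℕ) : zpowMap T (-n) = T.symm^[n] := by
  have : zpowMap T (-n) = ⇑(((T.toEquiv : Equiv.Perm X)⁻¹) ^ n) := by
    simp only [zpowMap, zpow_neg, zpow_natCast, inv_pow]
  rw [this, ← Equiv.Perm.iterate_eq_pow]
  rfl

theorem measurePreserving_zpowMap {m : Measure X} {T : X ≃ᵐ X} (hT : MeasurePreserving T m m)
    (k : ℤ) : MeasurePreserving (zpowMap T k) m m := by
  obtain ⟨n, rfl | rfl⟩ := k.eq_nat_or_neg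
  · have : zpowMap T n = T^[n] := funext fun x => (iterate_eq_zpowMap T n x).symm
    exact this ▸ hT.iterate n
  · exact zpowMap_neg_natCast T n ▸ (hT.symm T).iterate n

/-- By Fubini, `ρ · y` is integrable for almost every `y` only, so the dense sequence has to be
chosen among such `y`. -/
theorem exists_dense_sequence {m : Measure X} [IsProbabilityMeasure m] {ρ : X → X → ℝ}
    (hρ : ρ ∈ Adm m) : ∃ d : ℕ → X, (∀ i, Integrable (fun x => ρ x (d i)) m) ∧
      ∀ᵐ x ∂m, ∀ ε : ℝ, 0 < ε → ∃ i, ρ x (d i) < ε := by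
  obtain ⟨hadm, hint⟩ := hρ
  obtain ⟨S, hS, hsep⟩ := hadm.separable
  have hG := hint.prod_left_ae
  obtain ⟨D, hDS, hDc, hD⟩ := hsep.mono hadm.semimetric
    (S' := S ∩ {y | Integrable (fun x => ρ x y) m}) Set.inter_subset_left
  have hSG : ∀ᵐ x ∂m, x ∈ S ∩ {y | Integrable (fun x => ρ x y) m} := by
    filter_upwards [hS, hG] with x h1 h2 using ⟨h1, h2⟩
  obtain ⟨x, hx⟩ := hSG.exists
  obtain ⟨z, hz, -⟩ := hD x hx 1 one_pos
  obtain ⟨d, rfl⟩ := hDc.exists_eq_range ⟨z, hz⟩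
  refine ⟨d, fun i => (hDS ⟨i, rfl⟩).2, ?_⟩
  filter_upwards [hSG] with x hx ε hε
  obtain ⟨_, ⟨i, rfl⟩, hi⟩ := hD x hx ε hε
  exact ⟨i, hi⟩

/-- Adding `z` to an error term turns inequalities that hold off a null set into inequalities that
hold everywhere, at no cost in the integral. -/
theorem exists_lintegral_eq_zero_of_ae {m : Measure X} {p : X → Prop} (hp : ∀ᵐ x ∂m, p x) :
    ∃ z : X → ℝ≥0∞, Measurable z ∧ ∫⁻ x, z x ∂m = 0 ∧ ∀ x, ¬ p x → z x = ∞ := by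
  obtain ⟨t, hpt, ht, ht0⟩ := exists_measurable_superset_of_null (ae_iff.1 hp)
  refine ⟨t.indicator fun _ => ∞, measurable_const.indicator ht, ?_, fun x hx => ?_⟩
  · rw [lintegral_indicator_const ht, ht0, mul_zero]
  · exact Set.indicator_of_mem (hpt hx) _

theorem lintegral_ofReal_add_lt_top {m : Measure X} {f : X → ℝ} {z : X → ℝ≥0∞}
    (hf : Integrable f m) (hz0 : ∫⁻ x, z x ∂m = 0) (hz : Measurable z) :
    ∫⁻ x, (ENNReal.ofReal (f x) + z x) ∂m < ∞ := by
  rw [lintegral_add_right _ hz, hz0, add_zero]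
  exact (lintegral_mono fun x => ENNReal.ofReal_le_ofReal (le_abs_self _)).trans_lt
    (by simpa [hasFiniteIntegral_iff_norm] using hf.hasFiniteIntegral)

theorem exists_integrable_majorant {m : Measure X} [IsProbabilityMeasure m] {ρ : X → X → ℝ}
    (hρ : ρ ∈ Adm m) : ∃ u : X → ℝ≥0∞, Measurable u ∧ ∫⁻ x, u x ∂m < ∞ ∧
      ∀ x y, ENNReal.ofReal (ρ x y) ≤ u x + u y := by
  obtain ⟨d, hd, -⟩ := exists_dense_sequence hρ
  have hm := (hd 0).aestronglyMeasurable
  obtain ⟨z, hz, hz0, hzp⟩ := exists_lintegral_eq_zero_of_ae hm.ae_eq_mk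
  have hmk : Measurable (hm.mk _) := hm.stronglyMeasurable_mk.measurable
  have hle : ∀ x, ENNReal.ofReal (ρ x (d 0)) ≤ ENNReal.ofReal (hm.mk _ x) + z x := by
    intro x
    by_cases hx : ρ x (d 0) = hm.mk _ x
    · rw [hx]; exact le_self_add
    · simp [hzp x hx]
  refine ⟨fun x => ENNReal.ofReal (hm.mk _ x) + z x, hmk.ennreal_ofReal.add hz,
    lintegral_ofReal_add_lt_top ((hd 0).congr hm.ae_eq_mk) hz0 hz, fun x y => ?_⟩
  exact (hρ.1.semimetric.ofReal_triangle x y (d 0)).trans (add_le_add (hle x) (hle y))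

/-! ### Semimetrics controlled by translations of `ρ`. -/

/-- The sum of the translations of `ρ` by `T ^ k`, `|k| ≤ K`. -/
noncomputable def shiftSum (T : X ≃ᵐ X) (ρ : X → X → ℝ) (K : ℕ) (x y : X) : ℝ≥0∞ :=
  ∑ k ∈ Finset.Icc (-K : ℤ) K, ENNReal.ofReal (ρ (zpowMap T k x) (zpowMap T k y))

theorem shiftSum_comm {T : X ≃ᵐ X} {ρ : X → X → ℝ} (hρ : IsSemimetric ρ) (K : ℕ) (x y : X) :
    shiftSum T ρ K x y = shiftSum T ρ K y x :=
  Finset.sum_congr rfl fun k _ => by rw [hρ.symm]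

theorem shiftSum_mono (T : X ≃ᵐ X) (ρ : X → X → ℝ) {K K' : ℕ} (h : K ≤ K') (x y : X) :
    shiftSum T ρ K x y ≤ shiftSum T ρ K' x y :=
  Finset.sum_le_sum_of_subset (Finset.Icc_subset_Icc (by omega) (by omega))

theorem le_shiftSum (T : X ≃ᵐ X) (ρ : X → X → ℝ) (k : ℤ) (x y : X) :
    ENNReal.ofReal (ρ (zpowMap T k x) (zpowMap T k y)) ≤ shiftSum T ρ k.natAbs x y :=
  Finset.single_le_sum (f := fun k => ENNReal.ofReal (ρ (zpowMap T k x) (zpowMap T k y)))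
    (fun _ _ => zero_le) (Finset.mem_Icc.2 ⟨by omega, by omega⟩)

/-- `s` is bounded by multiples of finite sums of translations of `ρ`, up to an error
`g x + g y` with arbitrarily small integral of `g`. -/
def IsControlled (m : Measure X) (T : X ≃ᵐ X) (ρ : X → X → ℝ) (s : X → X → ℝ≥0∞) : Prop :=
  ∀ η : ℝ≥0∞, η ≠ 0 → ∃ (L : ℝ≥0) (K : ℕ) (g : X → ℝ≥0∞), Measurable g ∧ ∫⁻ x, g x ∂m ≤ η ∧
    ∀ x y, s x y ≤ L * shiftSum T ρ K x y + g x + g y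

variable {m : Measure X} {T : X ≃ᵐ X} {ρ : X → X → ℝ}

theorem IsControlled.of_approx {s : X → X → ℝ≥0∞}
    (h : ∀ η : ℝ≥0∞, η ≠ 0 → ∃ s' : X → X → ℝ≥0∞, IsControlled m T ρ s' ∧
      ∃ g : X → ℝ≥0∞, Measurable g ∧ ∫⁻ x, g x ∂m ≤ η ∧ ∀ x y, s x y ≤ s' x y + g x + g y) :
    IsControlled m T ρ s := by
  intro η hη
  have hη2 : η / 2 ≠ 0 := (ENNReal.half_pos hη).ne'
  obtain ⟨s', hs', g, hg, hgη, hle⟩ := h (η / 2) hη2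
  obtain ⟨L, K, g', hg', hgη', hle'⟩ := hs' (η / 2) hη2
  refine ⟨L, K, fun x => g' x + g x, hg'.add hg, ?_, fun x y => ?_⟩
  · rw [lintegral_add_right _ hg]
    exact (add_le_add hgη' hgη).trans_eq (ENNReal.add_halves η)
  · calc s x y ≤ s' x y + g x + g y := hle x y
      _ ≤ (L * shiftSum T ρ K x y + g' x + g' y) + g x + g y := by gcongr; exact hle' x y
      _ = _ := by ring

theorem IsControlled.mono {s s' : X → X → ℝ≥0∞} (h : IsControlled m T ρ s')
    (hle : ∀ x y, s x y ≤ s' x y) : IsControlled m T ρ s :=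
  .of_approx fun η _ => ⟨s', h, fun _ => 0, measurable_const, by simp, by simpa using hle⟩

theorem IsControlled.zero : IsControlled m T ρ fun _ _ => 0 := fun η _ =>
  ⟨0, 0, fun _ => 0, measurable_const, by simp, by simp⟩

theorem IsControlled.add {s s' : X → X → ℝ≥0∞} (h : IsControlled m T ρ s)
    (h' : IsControlled m T ρ s') : IsControlled m T ρ fun x y => s x y + s' x y := by
  intro η hη
  have hη2 : η / 2 ≠ 0 := (ENNReal.half_pos hη).ne'
  obtain ⟨L, K, g, hg, hgη, hle⟩ := h (η / 2) hη2
  obtain ⟨L', K', g', hg', hgη', hle'⟩ := h' (η / 2) hη2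
  refine ⟨L + L', max K K', fun x => g x + g' x, hg.add hg', ?_, fun x y => ?_⟩
  · rw [lintegral_add_right _ hg']
    exact (add_le_add hgη hgη').trans_eq (ENNReal.add_halves η)
  · calc s x y + s' x y ≤ (L * shiftSum T ρ (max K K') x y + g x + g y) +
          (L' * shiftSum T ρ (max K K') x y + g' x + g' y) := by
          refine add_le_add ((hle x y).trans ?_) ((hle' x y).trans ?_)
          · gcongr; exact shiftSum_mono T ρ (le_max_left _ _) x y
          · gcongr; exact shiftSum_mono T ρ (le_max_right _ _) x y
      _ = _ := by push_cast; ring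

theorem IsControlled.finsetSum {ι : Type*} (I : Finset ι) {s : ι → X → X → ℝ≥0∞}
    (h : ∀ i ∈ I, IsControlled m T ρ (s i)) :
    IsControlled m T ρ fun x y => ∑ i ∈ I, s i x y := by
  classical
  induction I using Finset.induction_on with
  | empty => simpa using IsControlled.zero
  | insert a I ha ih =>
    simp only [Finset.sum_insert ha]
    exact (h a (Finset.mem_insert_self _ _)).add
      (ih fun i hi => h i (Finset.mem_insert_of_mem hi))

theorem IsControlled.const_mul {s : X → X → ℝ≥0∞} (h : IsControlled m T ρ s) (c : ℕ) :
    IsControlled m T ρ fun x y => c * s x y := by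
  simpa using IsControlled.finsetSum (Finset.range c) fun _ _ => h

/-- A pair separated by the union is separated by one of the first `N` sets, unless its point in the
union lies in the tail `R N`, whose measure is small. -/
theorem IsControlled.cut_iUnion [IsFiniteMeasure m] {A : ℕ → Set X}
    (hA : ∀ i, MeasurableSet (A i)) (h : ∀ i, IsControlled m T ρ (cut (A i))) :
    IsControlled m T ρ (cut (⋃ i, A i)) := by
  refine .of_approx fun η hη => ?_
  let R : ℕ → Set X := fun N => (⋃ i, A i) \ ⋃ i < N, A i
  have hRm : ∀ N, MeasurableSet (R N) := fun N =>
    (MeasurableSet.iUnion hA).diff (.iUnion fun i => .iUnion fun _ => hA i)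
  have hR : Tendsto (m ∘ R) atTop (nhds 0) := by
    have h1 : ⋂ N, R N = ∅ := by
      refine Set.eq_empty_of_forall_notMem fun x hx => ?_
      have hx' := Set.mem_iInter.1 hx
      obtain ⟨i, hi⟩ := Set.mem_iUnion.1 (hx' 0).1
      exact (hx' (i + 1)).2 (Set.mem_iUnion₂.2 ⟨i, i.lt_succ_self, hi⟩)
    have := tendsto_measure_iInter_atTop (μ := m) (s := R) (fun N => (hRm N).nullMeasurableSet)
      (fun N N' hN => Set.sdiff_subset_sdiff_right
        (Set.biUnion_subset_biUnion_left fun i hi => lt_of_lt_of_le hi hN))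
      ⟨0, measure_ne_top _ _⟩
    rwa [h1, measure_empty] at this
  obtain ⟨N, hN⟩ := (hR.eventually (gt_mem_nhds (pos_iff_ne_zero.2 hη))).exists
  refine ⟨_, .finsetSum (Finset.range N) fun i _ => h i, (R N).indicator fun _ => 1,
    measurable_const.indicator (hRm N), ?_, ?_⟩
  · rw [lintegral_indicator_const (hRm N), one_mul]
    exact hN.le
  refine cut_le_of_symm (fun x y => ?_) fun x hx y hy => ?_
  · simp only [cut_comm _ x y]
    ring
  · refine le_trans ?_ le_self_add
    by_cases hxN : x ∈ ⋃ i < N, A i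
    · obtain ⟨i, hi, hxi⟩ := Set.mem_iUnion₂.1 hxN
      have hyi : y ∉ A i := fun hyi => hy (Set.mem_iUnion.2 ⟨i, hyi⟩)
      have h1 : cut (A i) x y = 1 := cut_eq_one fun hiff => hyi (hiff.1 hxi)
      calc 1 = cut (A i) x y := h1.symm
        _ ≤ _ := (Finset.single_le_sum (f := fun i => cut (A i) x y) (fun _ _ => zero_le)
            (Finset.mem_range.2 hi)).trans le_self_add
    · rw [Set.indicator_of_mem (show x ∈ R N from ⟨hx, hxN⟩)]
      exact le_add_self

/-- A sublevel set of a function that is `1`-Lipschitz for a translation of `ρ` off a null set. -/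
theorem IsControlled.cut_sublevel [IsFiniteMeasure m] (hρ : IsSemimetric ρ) {f F : X → ℝ} (hF : Measurable F)
    (hfF : ∀ᵐ x ∂m, f x = F x) {k : ℤ}
    (hf : ∀ x y, |f x - f y| ≤ ρ (zpowMap T k x) (zpowMap T k y)) (c : ℝ) :
    IsControlled m T ρ (cut {x | F x < c}) := by
  intro η hη
  obtain ⟨z, hz, hz0, hzp⟩ := exists_lintegral_eq_zero_of_ae hfF
  -- A thin strip below the level `c`. If `F x < c ≤ F y` and `x` is outside `R N`, the values
  -- differ by at least `1 / (N + 1)`, hence so do the translated points in `ρ`; this explains the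
  -- factor `N + 1`.
  let R : ℕ → Set X := fun n => {x | c - 1 / (n + 1) < F x ∧ F x < c}
  have hRm : ∀ N, MeasurableSet (R N) := fun N =>
    (measurableSet_lt measurable_const hF).inter (measurableSet_lt hF measurable_const)
  have hR : Tendsto (m ∘ R) atTop (nhds 0) := by
    have h1 : ⋂ N, R N = ∅ := by
      refine Set.eq_empty_of_forall_notMem fun x hx => ?_
      have hx' := Set.mem_iInter.1 hx
      obtain ⟨n, hn⟩ := exists_nat_one_div_lt (sub_pos.2 (hx' 0).2)
      linarith [(hx' n).1]
    have := tendsto_measure_iInter_atTop (μ := m) (s := R) (fun N => (hRm N).nullMeasurableSet)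
      (fun N N' hN x hx => ⟨lt_of_le_of_lt
        (sub_le_sub_left (Nat.one_div_le_one_div hN) c) hx.1, hx.2⟩)
      ⟨0, measure_ne_top _ _⟩
    rwa [h1, measure_empty] at this
  obtain ⟨N, hN⟩ := (hR.eventually (gt_mem_nhds (pos_iff_ne_zero.2 hη))).exists
  refine ⟨(N + 1 : ℕ), k.natAbs, fun x => (R N).indicator (fun _ => 1) x + z x,
    (measurable_const.indicator (hRm N)).add hz, ?_, ?_⟩
  · rw [lintegral_add_right _ hz, hz0, add_zero, lintegral_indicator_const (hRm N), one_mul]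
    exact hN.le
  refine cut_le_of_symm (fun x y => ?_) fun x (hx : F x < c) y (hy : ¬ F y < c) => ?_
  · rw [shiftSum_comm hρ]
    ring
  · rw [not_lt] at hy
    beta_reduce
    by_cases hx' : f x = F x
    swap
    · simp [hzp x hx']
    by_cases hy' : f y = F y
    swap
    · simp [hzp y hy']
    by_cases hxR : x ∈ R N
    · rw [Set.indicator_of_mem hxR]
      exact le_add_right (le_add_left le_self_add)
    · refine le_add_right (le_add_right ?_)
      refine le_trans ?_ (mul_le_mul_right (le_shiftSum T ρ k x y) _)
      have h1 : F x ≤ c - 1 / (N + 1) := by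
        by_contra hcon
        exact hxR ⟨not_le.1 hcon, hx⟩
      have h2 : 1 / ((N : ℝ) + 1) ≤ ρ (zpowMap T k x) (zpowMap T k y) := by
        refine le_trans ?_ (hf x y)
        rw [hx', hy', abs_sub_comm]
        exact le_trans (by linarith) (le_abs_self _)
      rw [ENNReal.coe_natCast, ← ENNReal.ofReal_natCast, ← ENNReal.ofReal_mul (by positivity), ← ENNReal.ofReal_one]
      refine ENNReal.ofReal_le_ofReal ?_
      have h3 : (0 : ℝ) < N + 1 := by positivity
      push_cast
      rw [div_le_iff₀ h3] at h2
      linarith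

/-! ### From generating semimetrics to control of all admissible ones. -/

/-- The measurable sets with controlled cut semimetric form a `σ`-algebra. -/
abbrev controlledSpace (m : Measure X) [IsFiniteMeasure m] (T : X ≃ᵐ X) (ρ : X → X → ℝ) :
    MeasurableSpace X where
  MeasurableSet' A := MeasurableSet A ∧ IsControlled m T ρ (cut A)
  measurableSet_empty := ⟨.empty, IsControlled.zero.mono fun x y => by simp [cut_eq_zero]⟩
  measurableSet_compl A hA := ⟨hA.1.compl, hA.2.mono fun x y => (cut_compl A x y).le⟩
  measurableSet_iUnion A hA := ⟨.iUnion fun i => (hA i).1,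
    .cut_iUnion (fun i => (hA i).1) fun i => (hA i).2⟩

/-- Lusin–Souslin: the translations of a generating semimetric control all measurable sets. -/
theorem isControlled_cut [StandardBorelSpace X] [IsProbabilityMeasure m]
    (hT : MeasurePreserving T m m) (hρ : ρ ∈ Adm m) (hgen : IsGenerating m T ρ) {A : Set X}
    (hA : MeasurableSet A) : IsControlled m T ρ (cut A) := by
  obtain ⟨d, hd, hdense⟩ := exists_dense_sequence hρ
  obtain ⟨S, hS, hsep⟩ := hgen
  have hsemi := hρ.1.semimetric
  let f : ℕ × ℤ → X → ℝ := fun p x => ρ (zpowMap T p.2 x) (d p.1)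
  have hf : ∀ p, AEMeasurable (f p) m := fun p =>
    (hd p.1).aemeasurable.comp_quasiMeasurePreserving
      (measurePreserving_zpowMap hT p.2).quasiMeasurePreserving
  let F : X → ℕ × ℤ → ℝ := fun x p => (hf p).mk (f p) x
  have hFm : Measurable F := measurable_pi_lambda _ fun p => (hf p).measurable_mk
  have hgood : ∀ᵐ x ∂m, x ∈ S ∧ (∀ p, f p x = F x p) ∧
      ∀ k, ∀ ε : ℝ, 0 < ε → ∃ i, ρ (zpowMap T k x) (d i) < ε := by
    have h1 : ∀ᵐ x ∂m, ∀ p, f p x = F x p := ae_all_iff.2 fun p => (hf p).ae_eq_mk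
    have h2 : ∀ᵐ x ∂m, ∀ k, ∀ ε : ℝ, 0 < ε → ∃ i, ρ (zpowMap T k x) (d i) < ε :=
      ae_all_iff.2 fun k =>
        (measurePreserving_zpowMap hT k).quasiMeasurePreserving.ae hdense
    filter_upwards [hS, h1, h2] with x a b c using ⟨a, b, c⟩
  obtain ⟨N, hN, hNm, hN0⟩ := exists_measurable_superset_of_null (ae_iff.1 hgood)
  have hgoodN : ∀ x ∈ Nᶜ, x ∈ S ∧ (∀ p, f p x = F x p) ∧
      ∀ k, ∀ ε : ℝ, 0 < ε → ∃ i, ρ (zpowMap T k x) (d i) < ε := fun x hx =>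
    by_contra fun h => hx (hN h)
  -- Equal coordinates mean equal distances from `T ^ k x` and `T ^ k y` to each `d i`; taking `d i`
  -- nearer than half of `ρ (T ^ k x) (T ^ k y)` contradicts the triangle inequality.
  have hinj : Set.InjOn F Nᶜ := by
    intro x hx y hy hxy
    by_contra hne
    obtain ⟨k, hk⟩ := hsep x (hgoodN x hx).1 y (hgoodN y hy).1 hne
    obtain ⟨i, hi⟩ := (hgoodN x hx).2.2 k _ (half_pos hk)
    have h1 : ρ (zpowMap T k x) (d i) = ρ (zpowMap T k y) (d i) := by
      have h2 := (hgoodN x hx).2.1 (i, k)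
      have h3 := (hgoodN y hy).2.1 (i, k)
      rw [hxy, ← h3] at h2
      exact h2
    have h4 := hsemi.triangle (zpowMap T k x) (d i) (zpowMap T k y)
    rw [hsemi.symm (d i), ← h1] at h4
    change _ < ρ (zpowMap T k x) (zpowMap T k y) / 2 at hi
    linarith
  -- Injectivity makes the image Borel, so off `N` the set `A` is a preimage under `F`. The map `F`
  -- is measurable for the controlled `σ`-algebra because its coordinates have controlled sublevel
  -- sets.
  have hB := (hA.diff hNm).image_of_measurable_injOn hFm (hinj.mono fun x hx => hx.2)
  have hFc : @Measurable X (ℕ × ℤ → ℝ) (controlledSpace m T ρ) _ F := by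
    refine @measurable_pi_lambda _ _ _ (controlledSpace m T ρ) _ F fun p => ?_
    refine @measurable_of_Iio _ _ _ _ _ (controlledSpace m T ρ) _ _ _ _ fun c => ?_
    have hp : Measurable fun x => F x p := (hf p).measurable_mk
    exact ⟨hp measurableSet_Iio, IsControlled.cut_sublevel hsemi hp (hf p).ae_eq_mk
      (fun x y => hsemi.abs_sub_le _ _ _) c⟩
  have hC : IsControlled m T ρ (cut (F ⁻¹' (F '' (A \ N)))) := (hFc hB).2
  refine .of_approx fun η _ => ⟨_, hC, N.indicator fun _ => ∞, measurable_const.indicator hNm,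
    ?_, fun x y => ?_⟩
  · simp [lintegral_indicator_const hNm, hN0]
  · by_cases hx : x ∈ N
    · simp [hx]
    by_cases hy : y ∈ N
    · simp [hy]
    have key : ∀ z ∉ N, z ∈ A ↔ z ∈ F ⁻¹' (F '' (A \ N)) := fun z hz =>
      ⟨fun hzA => ⟨z, ⟨hzA, hz⟩, rfl⟩, fun ⟨w, hw, hwz⟩ => hinj hw.2 hz hwz ▸ hw.1⟩
    refine le_add_right (le_add_right (cut_congr (key x hx) (key y hy)).le)

/-- Every summable admissible semimetric is controlled by the translations of a generating one. -/
theorem isControlled_of_generating [StandardBorelSpace X] [IsProbabilityMeasure m]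
    (hT : MeasurePreserving T m m) (hρ : ρ ∈ Adm m) (hgen : IsGenerating m T ρ)
    {σ : X → X → ℝ} (hσ : σ ∈ Adm m) :
    IsControlled m T ρ fun x y => ENNReal.ofReal (σ x y) := by
  obtain ⟨d, hd, hdense⟩ := exists_dense_sequence hσ
  have hsemi := hσ.1.semimetric
  let F : ℕ → X → ℝ := fun i => (hd i).aemeasurable.mk _
  have hFm : ∀ i, Measurable (F i) := fun i => (hd i).aemeasurable.measurable_mk
  have hgood : ∀ᵐ x ∂m, (∀ i, σ x (d i) = F i x) ∧ ∀ ε : ℝ, 0 < ε → ∃ i, σ x (d i) < ε := by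
    filter_upwards [ae_all_iff.2 fun i => (hd i).aemeasurable.ae_eq_mk, hdense] with x a b
      using ⟨a, b⟩
  obtain ⟨z, hz, hz0, hzp⟩ := exists_lintegral_eq_zero_of_ae hgood
  let u : X → ℝ≥0∞ := fun x => ENNReal.ofReal (F 0 x) + z x
  have hum : Measurable u := (hFm 0).ennreal_ofReal.add hz
  have huint : ∫⁻ x, u x ∂m < ∞ :=
    lintegral_ofReal_add_lt_top ((hd 0).congr (hd 0).aemeasurable.ae_eq_mk) hz0 hz
  have hσu : ∀ x y, ENNReal.ofReal (σ x y) ≤ u x + u y := by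
    have hle : ∀ x, ENNReal.ofReal (σ x (d 0)) ≤ u x := by
      intro x
      by_cases hx : σ x (d 0) = F 0 x
      · simp only [u, hx]; exact le_self_add
      · simp [u, hzp x fun h => hx (h.1 0)]
    exact fun x y => (hsemi.ofReal_triangle x y (d 0)).trans (add_le_add (hle x) (hle y))
  have hugood : ∀ x, u x ≠ ∞ →
      (∀ i, σ x (d i) = F i x) ∧ ∀ ε : ℝ, 0 < ε → ∃ i, σ x (d i) < ε :=
    fun x hx => by_contra fun h => hx (by simp [u, hzp x h])
  refine .of_approx fun η hη => ?_
  obtain ⟨τ, hτ, hτη⟩ : ∃ τ : ℝ, 0 < τ ∧ ENNReal.ofReal τ ≤ η / 3 := by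
    obtain ⟨q, hq, hqη⟩ := ENNReal.lt_iff_exists_nnreal_btwn.1
      (ENNReal.div_pos hη (by simp : (3 : ℝ≥0∞) ≠ ∞))
    exact ⟨q, by exact_mod_cast hq, by simpa using hqη.le⟩
  have hη3 : 0 < η / 3 := ENNReal.div_pos hη (by simp)
  let A : ℕ → Set X := fun i => {x | F i x < τ}
  have hAm : ∀ i, MeasurableSet (A i) := fun i => measurableSet_lt (hFm i) measurable_const
  let B : ℕ → Set X := fun N => ⋂ i < N, (A i)ᶜ
  have hBm : ∀ N, MeasurableSet (B N) := fun N => .iInter fun i => .iInter fun _ => (hAm i).compl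
  have hB : Tendsto (m ∘ B) atTop (nhds 0) := by
    have h1 : m (⋂ N, B N) = 0 := by
      refine measure_mono_null (fun x hx => ?_) (ae_iff.1 hgood)
      rintro ⟨h2, h3⟩
      obtain ⟨i, hi⟩ := h3 τ hτ
      exact Set.mem_iInter₂.1 (Set.mem_iInter.1 hx (i + 1)) i i.lt_succ_self
        (show F i x < τ from h2 i ▸ hi)
    have := tendsto_measure_iInter_atTop (μ := m) (s := B) (fun N => (hBm N).nullMeasurableSet)
      (fun N N' hN => Set.biInter_subset_biInter_left fun i hi => lt_of_lt_of_le hi hN)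
      ⟨0, measure_ne_top _ _⟩
    rwa [h1] at this
  let C : ℕ → Set X := fun M => {x | (M : ℝ≥0∞) < u x}
  have hCm : ∀ M, MeasurableSet (C M) := fun M => measurableSet_lt measurable_const hum
  have hC : Tendsto (m ∘ C) atTop (nhds 0) := by
    have h1 : m (⋂ M, C M) = 0 := by
      refine measure_mono_null (fun x hx => ?_) (ae_iff.1 (ae_lt_top hum huint.ne))
      intro hlt
      obtain ⟨M, hM⟩ := ENNReal.exists_nat_gt hlt.ne
      exact lt_asymm hM (Set.mem_iInter.1 hx M)
    have := tendsto_measure_iInter_atTop (μ := m) (s := C) (fun N => (hCm N).nullMeasurableSet)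
      (fun N N' hN x (hx : (N' : ℝ≥0∞) < u x) => show (N : ℝ≥0∞) < u x from
        lt_of_le_of_lt (Nat.cast_le.2 hN) hx)
      ⟨0, measure_ne_top _ _⟩
    rwa [h1] at this
  obtain ⟨N, hN⟩ := ((tendsto_setLIntegral_zero huint.ne hB).eventually (gt_mem_nhds hη3)).exists
  obtain ⟨M, hM⟩ := ((tendsto_setLIntegral_zero huint.ne hC).eventually (gt_mem_nhds hη3)).exists
  -- The three terms cost `η / 3` each: the radius `τ` of the balls `A i`, the points outside the
  -- first `N` balls, and the points where the majorant `u` exceeds `M`.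
  let g : X → ℝ≥0∞ := fun x => ENNReal.ofReal τ + (B N).indicator u x + (C M).indicator u x
  have hgB : ∀ x, (B N).indicator u x ≤ g x := fun x => le_add_right le_add_self
  have hgC : ∀ x, (C M).indicator u x ≤ g x := fun x => le_add_self
  have hu : ∀ x, u x ≤ M + g x := by
    intro x
    by_cases hx : x ∈ C M
    · have := hgC x
      rw [Set.indicator_of_mem hx] at this
      exact le_add_left this
    · exact le_add_right (not_lt.1 hx)
  have hg_top : ∀ x, u x = ∞ → g x = ∞ := fun x hx => by
    have := hu x
    rw [hx, top_le_iff, ENNReal.add_eq_top] at this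
    exact this.resolve_left (ENNReal.natCast_ne_top M)
  refine ⟨_, .const_mul (.finsetSum (Finset.range N)
    fun i _ => isControlled_cut hT hρ hgen (hAm i)) (2 * M), g,
    (measurable_const.add (hum.indicator (hBm N))).add (hum.indicator (hCm M)), ?_, ?_⟩
  · rw [lintegral_add_right _ (hum.indicator (hCm M)),
      lintegral_add_right _ (hum.indicator (hBm N)), lintegral_indicator (hBm N),
      lintegral_indicator (hCm M), lintegral_const, measure_univ, mul_one]
    exact (add_le_add (add_le_add hτη hN.le) hM.le).trans_eq (ENNReal.add_thirds η)
  · intro x y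
    -- Unseparated points either share a ball, and `τ` at each point suffices, or both lie in `B N`,
    -- and `u` is paid there. For separated points some cut equals `1`, and `2 * M` times it pays
    -- for the truncated majorant.
    by_cases hcut : ∀ i < N, x ∈ A i ↔ y ∈ A i
    · rw [add_assoc]
      refine le_add_left ?_
      by_cases hxB : x ∈ B N
      · have hyB : y ∈ B N := by
          simp only [B, Set.mem_iInter₂, Set.mem_compl_iff] at hxB ⊢
          exact fun i hi hyA => hxB i hi ((hcut i hi).2 hyA)
        have h1 := hgB x
        have h2 := hgB y
        rw [Set.indicator_of_mem hxB] at h1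
        rw [Set.indicator_of_mem hyB] at h2
        exact (hσu x y).trans (add_le_add h1 h2)
      · simp only [B, Set.mem_iInter₂, Set.mem_compl_iff, not_forall, not_not] at hxB
        obtain ⟨i, hi, hxA⟩ := hxB
        have hyA := (hcut i hi).1 hxA
        by_cases hx : u x = ∞
        · simp [hg_top x hx]
        by_cases hy : u y = ∞
        · simp [hg_top y hy]
        refine (hsemi.ofReal_triangle x y (d i)).trans (add_le_add ?_ ?_)
        · rw [(hugood x hx).1 i]
          exact (ENNReal.ofReal_le_ofReal (le_of_lt hxA)).trans (le_add_right le_self_add)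
        · rw [(hugood y hy).1 i]
          exact (ENNReal.ofReal_le_ofReal (le_of_lt hyA)).trans (le_add_right le_self_add)
    · push Not at hcut
      obtain ⟨i, hi, hxy⟩ := hcut
      have h1 : cut (A i) x y = 1 := cut_eq_one (by tauto)
      have h2 : 1 ≤ ∑ i ∈ Finset.range N, cut (A i) x y := by
        rw [← h1]
        exact Finset.single_le_sum (f := fun i => cut (A i) x y) (fun _ _ => zero_le)
          (Finset.mem_range.2 hi)
      calc ENNReal.ofReal (σ x y) ≤ u x + u y := hσu x y
        _ ≤ (M + g x) + (M + g y) := add_le_add (hu x) (hu y)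
        _ = ((2 * M : ℕ) : ℝ≥0∞) * 1 + g x + g y := by push_cast; ring
        _ ≤ _ := by gcongr

/-! ### Averaging along orbits. -/

theorem ofReal_averageSemimetric {σ : X → X → ℝ} (hσ : ∀ x y, 0 ≤ σ x y) {n : ℕ} (hn : n ≠ 0)
    (x y : X) : ENNReal.ofReal (averageSemimetric T n σ x y) = (n : ℝ≥0∞)⁻¹ *
      ∑ i ∈ Finset.range n, ENNReal.ofReal (σ (zpowMap T i x) (zpowMap T i y)) := by
  have hn' : (0 : ℝ) < n := by exact_mod_cast Nat.pos_of_ne_zero hn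
  rw [averageSemimetric, ENNReal.ofReal_mul (by positivity), one_div,
    ENNReal.ofReal_inv_of_pos hn', ENNReal.ofReal_natCast,
    ENNReal.ofReal_sum_of_nonneg fun _ _ => hσ _ _]
  simp only [iterate_eq_zpowMap]

/-- The integers at distance at most `K` from `[0, n)`, outside of `[0, n)`. -/
noncomputable def boundaryIndices (K n : ℕ) : Finset ℤ := Finset.Ico (-K : ℤ) 0 ∪ Finset.Ico (n : ℤ) (n + K)

theorem card_boundaryIndices_le (K n : ℕ) : (boundaryIndices K n).card ≤ 2 * K := by
  refine (Finset.card_union_le _ _).trans ?_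
  simp only [Int.card_Ico]
  omega

theorem sum_shift_le (r : ℤ → ℝ≥0∞) (K n : ℕ) {k : ℤ} (hk : k ∈ Finset.Icc (-K : ℤ) K) :
    ∑ i ∈ Finset.range n, r (i + k) ≤
      ∑ i ∈ Finset.range n, r i + ∑ j ∈ boundaryIndices K n, r j := by
  classical
  have h1 : ∀ l : ℤ, ∑ i ∈ Finset.range n, r (i + l) =
      ∑ j ∈ (Finset.range n).image fun i : ℕ => (i : ℤ) + l, r j := fun l =>
    (Finset.sum_image fun a _ b _ h => by simpa using h).symm
  have h2 := h1 0
  simp only [add_zero] at h2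
  rw [h1, h2, ← Finset.sum_union_inter]
  refine le_add_right (Finset.sum_le_sum_of_subset fun j hj => ?_)
  obtain ⟨i, hi, rfl⟩ := Finset.mem_image.1 hj
  simp only [Finset.mem_range, Finset.mem_Icc] at hi hk
  simp only [boundaryIndices, Finset.mem_union, Finset.mem_Ico, Finset.mem_image,
    Finset.mem_range]
  by_cases h : 0 ≤ (i : ℤ) + k ∧ (i : ℤ) + k < n
  · exact .inl ⟨((i : ℤ) + k).toNat, by omega, by omega⟩
  · omega

/-- Invariance preserves `∫ g` under averaging. Each of the `2 * K + 1` shifts of `[0, n)` costs one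
copy of the sum of `ρ` over `[0, n)` plus at most `2 * K` boundary terms, which `u` dominates. Thus
`C` does not depend on `n`. -/
theorem exists_average_le [IsProbabilityMeasure m] (hT : MeasurePreserving T m m)
    (hρ : ρ ∈ Adm m) {σ : X → X → ℝ} (hσ : ∀ x y, 0 ≤ σ x y)
    (hc : IsControlled m T ρ fun x y => ENNReal.ofReal (σ x y)) {η : ℝ≥0∞} (hη : η ≠ 0)
    (hη' : η ≠ ∞) :
    ∃ (C : ℝ≥0) (N : ℕ), ∀ n ≥ N, ∃ G : X → ℝ≥0∞, Measurable G ∧ ∫⁻ x, G x ∂m ≤ η ∧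
      ∀ x y, ENNReal.ofReal (averageSemimetric T n σ x y) ≤
        C * ENNReal.ofReal (averageSemimetric T n ρ x y) + G x + G y := by
  have hη2 : η / 2 ≠ 0 := (ENNReal.half_pos hη).ne'
  obtain ⟨L, K, g, hg, hgη, hle⟩ := hc (η / 2) hη2
  obtain ⟨u, hu, hu_int, hρu⟩ := exists_integrable_majorant hρ
  let C : ℝ≥0 := L * (2 * K + 1 : ℕ)
  -- A bound for the integral of the boundary terms before division by `n`; `N` is chosen so that `c
  -- / n ≤ η / 2` beyond it.
  let c : ℝ≥0∞ := C * ((2 * K : ℕ) * ∫⁻ x, u x ∂m)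
  have hc_top : c ≠ ∞ := by finiteness
  obtain ⟨N, hN⟩ := ENNReal.exists_nat_gt (ENNReal.div_ne_top hc_top hη2)
  have hZm : ∀ k, Measurable (zpowMap T k) := fun k => (measurePreserving_zpowMap hT k).measurable
  refine ⟨C, N + 1, fun n hn => ?_⟩
  have hn0 : n ≠ 0 := by omega
  have hn0' : (n : ℝ≥0∞) ≠ 0 := by exact_mod_cast hn0
  have hgm : Measurable fun x => ∑ i ∈ Finset.range n, g (zpowMap T i x) :=
    Finset.measurable_fun_sum _ fun i _ => hg.comp (hZm i)
  have hum : Measurable fun x => ∑ j ∈ boundaryIndices K n, u (zpowMap T j x) :=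
    Finset.measurable_fun_sum _ fun i _ => hu.comp (hZm i)
  refine ⟨fun x => (n : ℝ≥0∞)⁻¹ * ∑ i ∈ Finset.range n, g (zpowMap T i x) +
    (n : ℝ≥0∞)⁻¹ * (C * ∑ j ∈ boundaryIndices K n, u (zpowMap T j x)),
    (hgm.const_mul _).add ((hum.const_mul _).const_mul _), ?_, fun x y => ?_⟩
  · rw [lintegral_add_left (hgm.const_mul _), lintegral_const_mul _ hgm,
      lintegral_const_mul _ (hum.const_mul _), lintegral_const_mul _ hum,
      lintegral_finsetSum (f := fun (i : ℕ) x => g (zpowMap T i x)) _ fun i _ => hg.comp (hZm i),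
      lintegral_finsetSum (f := fun j x => u (zpowMap T j x)) _ fun j _ => hu.comp (hZm j)]
    simp only [(measurePreserving_zpowMap hT _).lintegral_comp hg,
      (measurePreserving_zpowMap hT _).lintegral_comp hu, Finset.sum_const, Finset.card_range,
      nsmul_eq_mul]
    rw [← mul_assoc, ENNReal.inv_mul_cancel hn0' (ENNReal.natCast_ne_top n), one_mul,
      ← ENNReal.add_halves η]
    refine add_le_add hgη ?_
    calc (n : ℝ≥0∞)⁻¹ * (C * ((boundaryIndices K n).card * ∫⁻ x, u x ∂m))
        ≤ (n : ℝ≥0∞)⁻¹ * c := by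
          simp only [c]; gcongr; exact card_boundaryIndices_le K n
      _ ≤ η / 2 := by
          rw [mul_comm, ← div_eq_mul_inv]
          refine ENNReal.div_le_of_le_mul ?_
          have h1 : c / (η / 2) ≤ n := hN.le.trans (by exact_mod_cast (by omega : N ≤ n))
          rw [mul_comm]
          exact (ENNReal.div_le_iff hη2 (ENNReal.div_ne_top hη' two_ne_zero)).1 h1
  · rw [ofReal_averageSemimetric hσ hn0, ofReal_averageSemimetric hρ.1.semimetric.nonneg hn0]
    let r : ℤ → ℝ≥0∞ := fun j => ENNReal.ofReal (ρ (zpowMap T j x) (zpowMap T j y))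
    have h1 : ∀ i : ℕ, shiftSum T ρ K (zpowMap T i x) (zpowMap T i y) =
        ∑ k ∈ Finset.Icc (-K : ℤ) K, r (i + k) := fun i =>
      Finset.sum_congr rfl fun k _ => by simp only [r, add_comm (i : ℤ), zpowMap_add]
    have h2 : ∑ i ∈ Finset.range n, ∑ k ∈ Finset.Icc (-K : ℤ) K, r (i + k) ≤
        (2 * K + 1 : ℕ) * (∑ i ∈ Finset.range n, r i + ∑ j ∈ boundaryIndices K n, r j) := by
      rw [Finset.sum_comm]
      refine (Finset.sum_le_card_nsmul _ _ _ fun k hk => sum_shift_le r K n hk).trans_eq ?_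
      rw [nsmul_eq_mul, Int.card_Icc]
      congr 2
      omega
    have h3 : ∑ j ∈ boundaryIndices K n, r j ≤ ∑ j ∈ boundaryIndices K n, u (zpowMap T j x) +
        ∑ j ∈ boundaryIndices K n, u (zpowMap T j y) := by
      rw [← Finset.sum_add_distrib]
      exact Finset.sum_le_sum fun j _ => hρu _ _
    calc (n : ℝ≥0∞)⁻¹ * ∑ i ∈ Finset.range n, ENNReal.ofReal (σ (zpowMap T i x) (zpowMap T i y))
        ≤ (n : ℝ≥0∞)⁻¹ * ∑ i ∈ Finset.range n, (L * (∑ k ∈ Finset.Icc (-K : ℤ) K, r (i + k)) +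
            g (zpowMap T i x) + g (zpowMap T i y)) := by
          gcongr with i
          rw [← h1]
          exact hle _ _
      _ = (n : ℝ≥0∞)⁻¹ * (L * ∑ i ∈ Finset.range n, ∑ k ∈ Finset.Icc (-K : ℤ) K, r (i + k) +
            ∑ i ∈ Finset.range n, g (zpowMap T i x) +
            ∑ i ∈ Finset.range n, g (zpowMap T i y)) := by
          rw [Finset.sum_add_distrib, Finset.sum_add_distrib, Finset.mul_sum]
      _ ≤ (n : ℝ≥0∞)⁻¹ * (L * ((2 * K + 1 : ℕ) * (∑ i ∈ Finset.range n, r i +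
            (∑ j ∈ boundaryIndices K n, u (zpowMap T j x) +
              ∑ j ∈ boundaryIndices K n, u (zpowMap T j y)))) +
            ∑ i ∈ Finset.range n, g (zpowMap T i x) +
            ∑ i ∈ Finset.range n, g (zpowMap T i y)) := by
          gcongr
          exact h2.trans (by gcongr)
      _ = _ := by simp only [C, r]; push_cast; ring

/-! ### Comparison of covers and entropies. -/

/-- The bound on `∫ G` is `(ε / 4) ^ 2`, so by Markov `G < ε / 4` off a set `B` of measure at most
`ε / 4`. Moving `B` into the exceptional set leaves pieces of diameter at most `3 * ε / 4`. -/
theorem HasCover.of_le {σ τ : X → X → ℝ} {C : ℝ≥0} {G : X → ℝ≥0∞} (hG : Measurable G) {ε : ℝ}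
    (hε : 0 < ε) (hGint : ∫⁻ x, G x ∂m ≤ ENNReal.ofReal (ε ^ 2 / 16))
    (hle : ∀ x y, ENNReal.ofReal (σ x y) ≤ C * ENNReal.ofReal (τ x y) + G x + G y) {δ : ℝ}
    (hδ : δ ≤ ε / 2) (hCδ : C * δ ≤ ε / 4) {k : ℕ} (h : HasCover m τ δ k) :
    HasCover m σ ε k := by
  obtain ⟨X₀, Y, hX₀, hY, hun, hX₀m, hYd⟩ := h
  let B : Set X := {x | ENNReal.ofReal (ε / 4) ≤ G x}
  have hB : MeasurableSet B := measurableSet_le measurable_const hG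
  have ht : ENNReal.ofReal (ε / 4) ≠ 0 := by simpa using hε
  have hBm : m B ≤ ENNReal.ofReal (ε / 4) := by
    refine (meas_ge_le_lintegral_div hG.aemeasurable ht ENNReal.ofReal_ne_top).trans ?_
    refine ENNReal.div_le_of_le_mul (hGint.trans_eq ?_)
    rw [← ENNReal.ofReal_mul (by positivity)]
    congr 1
    ring
  refine ⟨X₀ ∪ B, fun j => Y j \ B, hX₀.union hB, fun j => (hY j).diff hB, ?_, ?_, fun j => ?_⟩
  · refine Set.eq_univ_of_forall fun x => ?_
    have hx : x ∈ X₀ ∪ ⋃ j, Y j := hun ▸ Set.mem_univ x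
    by_cases hxB : x ∈ B
    · exact .inl (.inr hxB)
    · refine hx.imp Or.inl fun h => ?_
      obtain ⟨j, hj⟩ := Set.mem_iUnion.1 h
      exact Set.mem_iUnion.2 ⟨j, hj, hxB⟩
  · calc m (X₀ ∪ B) ≤ m X₀ + m B := measure_union_le _ _
      _ ≤ ENNReal.ofReal (ε / 2) + ENNReal.ofReal (ε / 4) :=
          add_le_add (hX₀m.le.trans (ENNReal.ofReal_le_ofReal hδ)) hBm
      _ = ENNReal.ofReal (ε / 2 + ε / 4) := (ENNReal.ofReal_add (by positivity) (by positivity)).symm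
      _ < ENNReal.ofReal ε := (ENNReal.ofReal_lt_ofReal_iff hε).2 (by linarith)
  · refine lt_of_le_of_lt (b := ENNReal.ofReal (3 * ε / 4)) (diam_le_iff.2 fun x hx y hy => ?_)
      ((ENNReal.ofReal_lt_ofReal_iff hε).2 (by linarith))
    have hxy : ENNReal.ofReal (τ x y) ≤ ENNReal.ofReal δ :=
      diam_le_iff.1 (hYd j).le x hx.1 y hy.1
    calc ENNReal.ofReal (σ x y) ≤ C * ENNReal.ofReal (τ x y) + G x + G y := hle x y
      _ ≤ ENNReal.ofReal (ε / 4) + ENNReal.ofReal (ε / 4) + ENNReal.ofReal (ε / 4) := by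
          refine add_le_add (add_le_add ?_ (not_le.1 hx.2).le) (not_le.1 hy.2).le
          calc C * ENNReal.ofReal (τ x y) ≤ C * ENNReal.ofReal δ := by gcongr
            _ = ENNReal.ofReal (C * δ) := by
                rw [ENNReal.ofReal_mul C.coe_nonneg, ENNReal.ofReal_coe_nnreal]
            _ ≤ _ := ENNReal.ofReal_le_ofReal hCδ
      _ = ENNReal.ofReal (3 * ε / 4) := by
          rw [← ENNReal.ofReal_add (by positivity) (by positivity),
            ← ENNReal.ofReal_add (by positivity) (by positivity)]
          congr 1
          ring

theorem epsEntropy_le_of_hasCover {σ : X → X → ℝ} {ε : ℝ} {k : ℕ} (h : HasCover m σ ε k) :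
    epsEntropy m σ ε ≤ ENNReal.ofReal (Real.log k) := by
  rw [epsEntropy]
  split_ifs
  · exact zero_le
  · exact iInf₂_le k h

theorem le_epsEntropy {σ : X → X → ℝ} {ε : ℝ} (hε : ε < 1) {a : ℝ≥0∞}
    (h : ∀ k, HasCover m σ ε k → a ≤ ENNReal.ofReal (Real.log k)) : a ≤ epsEntropy m σ ε := by
  rw [epsEntropy, if_neg hε.not_ge]
  exact le_iInf₂ h

theorem HasCover.mono {σ : X → X → ℝ} {δ ε : ℝ} (hδ : δ ≤ ε) {k : ℕ} (h : HasCover m σ δ k) :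
    HasCover m σ ε k := by
  obtain ⟨X₀, Y, hX₀, hY, hun, hX₀m, hYd⟩ := h
  exact ⟨X₀, Y, hX₀, hY, hun, hX₀m.trans_le (ENNReal.ofReal_le_ofReal hδ),
    fun j => (hYd j).trans_le (ENNReal.ofReal_le_ofReal hδ)⟩

theorem epsEntropy_antitone (σ : X → X → ℝ) : Antitone (epsEntropy m σ) := by
  intro δ ε h
  by_cases hε : 1 ≤ ε
  · rw [epsEntropy, if_pos hε]; exact zero_le
  · exact le_epsEntropy (by linarith) fun k hk => epsEntropy_le_of_hasCover (hk.mono h)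

/-- The entropy function of a generating semimetric dominates that of any other one. -/
theorem entropyFunction_asympLE [StandardBorelSpace X] [IsProbabilityMeasure m]
    (hT : MeasurePreserving T m m) (hρ : ρ ∈ Adm m) (hgen : IsGenerating m T ρ)
    {σ : X → X → ℝ} (hσ : σ ∈ Adm m) :
    AsympLE (entropyFunction m T σ) (entropyFunction m T ρ) := by
  intro ε hε
  by_cases hε1 : 1 ≤ ε
  · exact ⟨1, one_pos, 0, .of_forall fun n => by simp [entropyFunction, epsEntropy, hε1]⟩
  obtain ⟨C, N, hN⟩ := exists_average_le hT hρ hσ.1.semimetric.nonneg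
    (isControlled_of_generating hT hρ hgen hσ)
    (ENNReal.ofReal_pos.2 (by positivity)).ne'
    (ENNReal.ofReal_ne_top (r := ε ^ 2 / 16))
  have hC : (0 : ℝ) ≤ C := C.2
  have hδ : ε / (4 * (C + 1)) ≤ ε / 2 :=
    div_le_div_of_nonneg_left hε.le two_pos (by linarith)
  -- This scale satisfies both requirements of `HasCover.of_le`, `δ ≤ ε / 2` and `C * δ ≤ ε / 4`.
  refine ⟨ε / (4 * (C + 1)), by positivity, 1, eventually_atTop.2 ⟨N, fun n hn => ?_⟩⟩
  obtain ⟨G, hG, hGint, hle⟩ := hN n hn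
  rw [ENNReal.coe_one, one_mul]
  refine le_epsEntropy (by linarith) fun k hk => epsEntropy_le_of_hasCover
    (HasCover.of_le hG hε hGint hle hδ ?_ hk)
  rw [← mul_div_assoc, div_le_div_iff₀ (by positivity) (by positivity)]
  nlinarith

theorem AsympLE.trans {Φ Ψ Ξ : ℝ → ℕ → ℝ≥0∞} (h₁ : AsympLE Φ Ψ) (h₂ : AsympLE Ψ Ξ) :
    AsympLE Φ Ξ := by
  intro ε hε
  obtain ⟨δ, hδ, C, hC⟩ := h₁ ε hε
  obtain ⟨δ', hδ', C', hC'⟩ := h₂ δ hδ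
  refine ⟨δ', hδ', C * C', ?_⟩
  filter_upwards [hC, hC'] with n h h'
  calc Φ ε n ≤ C * Ψ δ n := h
    _ ≤ C * (C' * Ξ δ' n) := by gcongr
    _ = _ := by push_cast; ring

theorem AsympLE.refl (Φ : ℝ → ℕ → ℝ≥0∞) : AsympLE Φ Φ := fun ε hε =>
  ⟨ε, hε, 1, .of_forall fun n => by simp⟩

/-! ### One metric that is generating for every measure. -/

/-- A bounded measurable metric on a standard Borel space. -/
noncomputable def realMetric (X : Type*) [MeasurableSpace X] [StandardBorelSpace X] :
    X → X → ℝ :=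
  fun x y => |Real.arctan (embeddingReal X x) - Real.arctan (embeddingReal X y)|

theorem isSemimetric_realMetric [StandardBorelSpace X] : IsSemimetric (realMetric X) where
  nonneg _ _ := abs_nonneg _
  self _ := by simp [realMetric]
  symm _ _ := abs_sub_comm _ _
  triangle _ _ _ := abs_sub_le _ _ _

theorem measurable_realMetric [StandardBorelSpace X] :
    Measurable (Function.uncurry (realMetric X)) := by
  have h : Measurable fun x : X => Real.arctan (embeddingReal X x) :=
    Real.measurable_arctan.comp (measurableEmbedding_embeddingReal X).measurable
  exact ((h.comp measurable_fst).sub (h.comp measurable_snd)).abs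

theorem realMetric_pos [StandardBorelSpace X] {x y : X} (h : x ≠ y) : 0 < realMetric X x y :=
  abs_pos.2 (sub_ne_zero.2 fun h' =>
    h ((measurableEmbedding_embeddingReal X).injective (Real.arctan_injective h')))

theorem realMetric_mem_Adm [StandardBorelSpace X] (m : Measure X) [IsProbabilityMeasure m] :
    realMetric X ∈ Adm m := by
  refine ⟨⟨isSemimetric_realMetric, measurable_realMetric.aemeasurable, Set.univ, by simp, ?_⟩,
    Integrable.of_bound (measurable_realMetric.aestronglyMeasurable) Real.pi
      (.of_forall fun p => ?_)⟩
  · obtain ⟨D, hDc, hD⟩ := TopologicalSpace.exists_countable_dense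
      (Set.range fun x : X => Real.arctan (embeddingReal X x))
    choose f hf using fun z : Set.range fun x : X => Real.arctan (embeddingReal X x) => z.2
    refine ⟨f '' D, Set.subset_univ _, hDc.image f, fun x _ ε hε => ?_⟩
    obtain ⟨z, hz, hxz⟩ := hD.exists_dist_lt ⟨_, x, rfl⟩ hε
    refine ⟨f z, Set.mem_image_of_mem f hz, ?_⟩
    rw [Subtype.dist_eq, Real.dist_eq, ← hf z] at hxz
    exact hxz
  · obtain ⟨x, y⟩ := p
    simp only [Function.uncurry, realMetric, Real.norm_eq_abs, abs_abs]
    have h1 := Real.neg_pi_div_two_lt_arctan (embeddingReal X x)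
    have h2 := Real.arctan_lt_pi_div_two (embeddingReal X x)
    have h3 := Real.neg_pi_div_two_lt_arctan (embeddingReal X y)
    have h4 := Real.arctan_lt_pi_div_two (embeddingReal X y)
    exact abs_le.2 ⟨by linarith, by linarith⟩

theorem isGenerating_realMetric [StandardBorelSpace X] (m : Measure X) (T : X ≃ᵐ X) :
    IsGenerating m T (realMetric X) :=
  ⟨Set.univ, by simp, fun _ _ _ _ h => ⟨0, realMetric_pos h⟩⟩

/-! ### Passage from the components to the mixture. -/

/-- Markov's inequality for the exceptional set of a cover: a cover for a mixture of measures is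
a cover for some component from any given set of indices of not too small outer measure. -/
theorem exists_hasCover_component {A : Type*} [MeasurableSpace A] {ν : Measure A}
    {κ : Kernel A X} {E : Set A} {δ ε : ℝ} (hεδ : ε ≤ δ)
    (hε : ENNReal.ofReal ε ≤ ENNReal.ofReal δ * ν E) {σ : X → X → ℝ} {k : ℕ}
    (h : HasCover (ν.bind κ) σ ε k) : ∃ α ∈ E, HasCover (κ α) σ δ k := by
  obtain ⟨X₀, Y, hX₀, hY, hun, hX₀m, hYd⟩ := h
  rw [Measure.bind_apply hX₀ κ.measurable.aemeasurable] at hX₀m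
  obtain ⟨α, hαE, hα⟩ : ∃ α ∈ E, κ α X₀ < ENNReal.ofReal δ := by
    by_contra! hcon
    -- The superset is measurable although `E` need not be, so Markov's inequality bounds the outer
    -- measure of `E`.
    have h1 : ν E ≤ ν {α | ENNReal.ofReal δ ≤ κ α X₀} := measure_mono hcon
    have h2 := mul_meas_ge_le_lintegral (μ := ν) (κ.measurable_coe hX₀) (ENNReal.ofReal δ)
    exact absurd (h2.trans_lt hX₀m) (not_lt.2 (hε.trans (by gcongr)))
  exact ⟨α, hαE, X₀, Y, hX₀, hY, hun, hα,
    fun j => (hYd j).trans_le (ENNReal.ofReal_le_ofReal hεδ)⟩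

end ScalingEntropy

/-- Here `κ α` is the ergodic component with index `α`. The hypothesis on the components is asked
for some representative of their scaling entropy only, and the conclusion is drawn for every
representative of the (nonempty) scaling entropy of the whole system, so that the independence of
the scaling entropy of the generating semimetric is not presupposed. -/
theorem mainTheorem7 {X : Type*} [MeasurableSpace X] [StandardBorelSpace X]
    (μ : Measure X) [IsProbabilityMeasure μ]
    (T : X ≃ᵐ X) (hT : MeasurePreserving T μ μ)
    {A : Type*} [MeasurableSpace A] (ν : Measure A) [IsProbabilityMeasure ν]
    (κ : Kernel A X) [IsMarkovKernel κ]
    (hμ : μ = ν.bind κ) (herg : ∀ᵐ α ∂ν, Ergodic T (κ α))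
    (h : ℕ → ℝ≥0) (E : Set A) (hE : 0 < ν E)
    (hdom : ∀ α ∈ E, ∃ Φ ∈ ScalingEntropy.scalingEntropy (κ α) T,
      ScalingEntropy.AsympLE (fun _ n => (h n : ℝ≥0∞)) Φ) :
    (ScalingEntropy.scalingEntropy μ T).Nonempty ∧
      ∀ Φ ∈ ScalingEntropy.scalingEntropy μ T,
        ScalingEntropy.AsympLE (fun _ n => (h n : ℝ≥0∞)) Φ := by
  open ScalingEntropy in
  refine ⟨⟨_, realMetric X, realMetric_mem_Adm μ, isGenerating_realMetric μ T, .refl _, .refl _⟩,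
    fun Φ hΦ => ?_⟩
  obtain ⟨ρ, hρ, hgen, -, hρΦ⟩ := hΦ
  refine AsympLE.trans ?_ ((entropyFunction_asympLE hT hρ hgen (realMetric_mem_Adm μ)).trans hρΦ)
  -- One integer encodes the threshold in `n`, the constant and the scale, so countably many sets
  -- exhaust the good indices. They need not be measurable; outer measure suffices.
  let F : ℕ → Set A := fun p => {α | ∀ n ≥ p,
    (h n : ℝ≥0∞) ≤ p * entropyFunction (κ α) T (realMetric X) (1 / (p + 1)) n}
  have hEF : E ∩ {α | Ergodic T (κ α)} ⊆ ⋃ p, F p := by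
    rintro α ⟨hα, hαerg⟩
    obtain ⟨Ψ, ⟨σ, hσ, -, hΨσ, -⟩, hΨ⟩ := hdom α hα
    -- As `h` does not depend on `ε`, the single value `1` carries all the information.
    obtain ⟨δ, hδ, C, hC⟩ := (hΨ.trans hΨσ).trans
      (entropyFunction_asympLE hαerg.toMeasurePreserving (realMetric_mem_Adm (κ α))
        (isGenerating_realMetric (κ α) T) hσ) 1 one_pos
    obtain ⟨N, hN⟩ := eventually_atTop.1 hC
    obtain ⟨a, ha⟩ := exists_nat_one_div_lt hδ
    obtain ⟨b, hb⟩ := exists_nat_ge C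
    refine Set.mem_iUnion.2 ⟨max N (max a b), fun n hn => ?_⟩
    refine (hN n ((le_max_left _ _).trans hn)).trans ?_
    refine mul_le_mul' ?_ (epsEntropy_antitone _ ?_)
    · have hb' : C ≤ (max N (max a b) : ℕ) :=
        hb.trans (by exact_mod_cast (le_max_right _ _).trans (le_max_right _ _))
      exact_mod_cast hb'
    · exact (Nat.one_div_le_one_div ((le_max_left a b).trans (le_max_right _ _))).trans ha.le
  obtain ⟨p, hp⟩ : ∃ p, ν (F p) ≠ 0 := by
    by_contra! hcon
    have h1 := measure_mono_null hEF (measure_iUnion_null hcon)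
    refine hE.ne' (measure_mono_null (fun α hα => ?_) (measure_union_null h1 (ae_iff.1 herg)))
    exact (em (Ergodic T (κ α))).imp (fun hα' => ⟨hα, hα'⟩) id
  intro _ _
  have hδ : (0 : ℝ) < 1 / (p + 1) := by positivity
  obtain ⟨q, hq, hqlt⟩ := ENNReal.lt_iff_exists_nnreal_btwn.1
    (ENNReal.mul_pos (ENNReal.ofReal_pos.2 hδ).ne' hp)
  have hq0 : (0 : ℝ) < q := by exact_mod_cast hq
  -- The bound `q` is the Markov threshold, `1 / (p + 1)` the scale in `F p`, and `1 / 2` keeps the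
  -- entropy out of the range where it is `0` by convention.
  refine ⟨min q (min (1 / (p + 1)) (1 / 2)), by positivity, p,
    eventually_atTop.2 ⟨p, fun n hn => ?_⟩⟩
  by_cases hp0 : p = 0
  · subst hp0
    obtain ⟨α, hα⟩ := nonempty_of_measure_ne_zero hp
    simpa using hα n hn
  have hp0' : (p : ℝ≥0∞) ≠ 0 := by exact_mod_cast hp0
  suffices hdiv : (h n : ℝ≥0∞) / p ≤ entropyFunction μ T (realMetric X)
      (min q (min (1 / (p + 1)) (1 / 2))) n by
    rw [mul_comm]
    exact_mod_cast (ENNReal.div_le_iff hp0' (ENNReal.natCast_ne_top p)).1 hdiv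
  refine le_epsEntropy (by
    have : min (q : ℝ) (min (1 / (p + 1)) (1 / 2)) ≤ 1 / 2 :=
      (min_le_right _ _).trans (min_le_right _ _)
    linarith) fun k hk => ?_
  rw [hμ] at hk
  obtain ⟨α, hα, hcov⟩ := exists_hasCover_component (E := F p)
    ((min_le_right _ _).trans (min_le_left _ _))
    ((ENNReal.ofReal_le_ofReal (min_le_left _ _)).trans
      (by rw [ENNReal.ofReal_coe_nnreal]; exact hqlt.le)) hk
  rw [ENNReal.div_le_iff hp0' (ENNReal.natCast_ne_top p), mul_comm]
  exact (hα n hn).trans (by gcongr; exact epsEntropy_le_of_hasCover hcov)
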